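/- **Machine model.** Let $\#$ be a symbol outside the finite alphabet $\Gamma$. The convolution of strings $w_1,\dots,w_k\in\Gamma^*$ is the string over $(\Gamma\cup\{\#\})^k$ obtained by writing the $w_i$ below each other, aligned at their first symbols, and filling up the shorter ones with $\#$ to the length of the longest one. A relation on $\Gamma^*$ is automatic if the set of convolutions of its tuples is regular; a function is automatic if its graph is. A deterministic exponential-size padded automatic register machine (ExpARM) has a finite alphabet $\Gamma$ containing the input alphabet $\Sigma$ and a padding symbol $0$, finitely many registers holding strings over $\Gamma$ (all empty at the start), and a program, i.e. a finite list of instructions of the following kinds: $R_i\leftarrow w$ for a fixed string $w\in\Sigma^*$; $R_i\leftarrow R_j$; $R_i\leftarrow F(R_{a_1},\dots,R_{a_k})$ with $F$ an automatic function; goto a line; goto a line if an automatic relation holds of given registers; write a register; halt, accept, reject; and $\mathrm{read\_and\_boost}(R_i,R_j,p,q)$ with polynomials $p,q$. The last one can be executed only once in a computation; it puts the input, of length $n$, into $R_i$ and a string $0^\ell$ into $R_j$, where $\ell\ge 2^{p(n)}q(n)$ is otherwise chosen by an adversary. Executing one instruction is one step. $\mathrm{ExpDAL}[f(n)]$ is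 the class of languages $L$ for which there are such a machine and a bound $t(n)=O(f(n))$ such that, on every input of length $n$ and for every choice of $\ell$, the machine halts within $t(n)$ steps, accepting if the input is in $L$ and rejecting otherwise. **Coding.** Consider closed quantified Boolean formulas $Q_{m-1}v_{m-1}\cdots Q_1v_1\,Q_0v_0\,\varphi$ with $Q_i\in\{\exists,\forall\}$ and $\varphi$ a conjunction of clauses, a clause being a disjunction of literals. Such a formula is correctly coded by a string over $\{\exists,\forall,0,1,[,],+,-,\_,\text{comma},\text{semicolon}\}$ if: 1. the string starts with the quantifier prefix, in which each quantifier is followed by its variable, and the variables are ordered as $m-1,m-2,\dots,1,0$; 2. each variable is written as its number in binary with exactly $k$ digits, where $m\le 2^k<2m$; 3. the inner part follows in square brackets; a literal is $+$ (non-negated) or $-$ (negated) followed by the variable and by $\_$; literals in a clause are separated by commas and clauses by semicolons; 4. each of the variables $0,\dots,m-1$ occurs in the inner part; 5. no clause logically implies another clause. For example, $\exists 10\,\forall 01\,\exists 00\,[+00\_,+01\_,+10\_;-01\_,-10\_]$ is a correct coding with $m=3$ and $k=2$. **Theorem.** The problem QSAT is in $\mathrm{ExpDAL}[n]$: there is a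 language $L\in\mathrm{ExpDAL}[n]$ such that, for every string $x$ which is a correct coding of a quantified Boolean formula $\Phi$, $x\in L$ if and only if $\Phi$ is true. (On strings that are not correct codings, $L$ is not prescribed.) -/

import Mathlib

/-! ### Convolutions, automatic relations and automatic functions -/

/-- The convolution of a tuple of strings: the strings are written one below the other, aligned at
their first symbols, and the shorter ones are filled up to the length of the longest one. The
filling symbol, which is not in the alphabet `Γ`, is `none : Option Γ`. -/
def conv {Γ : Type} {k : ℕ} (w : Fin k → List Γ) : List (Fin k → Option Γ) :=
  (List.range (Finset.univ.sup fun i => (w i).length)).map fun t i => (w i)[t]?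

/-- A `k`-ary relation on strings is automatic iff the set of convolutions of the tuples in it is a
regular language. -/
def IsAutomaticRel {Γ : Type} {k : ℕ} (R : (Fin k → List Γ) → Prop) : Prop :=
  Language.IsRegular ({u | ∃ w, R w ∧ u = conv w} : Language (Fin k → Option Γ))

/-- A `k`-ary function on strings is automatic iff its graph, the `(k+1)`-ary relation of the tuples
`(F w, w 0, …, w (k-1))`, is automatic. -/
def IsAutomaticFun {Γ : Type} {k : ℕ} (F : (Fin k → List Γ) → List Γ) : Prop :=
  IsAutomaticRel fun v : Fin (k + 1) → List Γ => v 0 = F (Fin.tail v)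

/-- An automatic function of `k` strings. -/
structure AutFun (Γ : Type) (k : ℕ) where
  toFun : (Fin k → List Γ) → List Γ
  automatic : IsAutomaticFun toFun

/-- An automatic relation between `k` strings. -/
structure AutRel (Γ : Type) (k : ℕ) where
  holds : (Fin k → List Γ) → Prop
  automatic : IsAutomaticRel holds

/-! ### Deterministic automatic register machines with exponential padding -/

/-- The instructions of a deterministic automatic register machine with machine alphabet `Γ`, input
alphabet `Sig` and `r` registers, where reading the input is replaced by reading and boosting. -/
inductive Instr (Γ Sig : Type) (r : ℕ) : Type
  /-- `read_and_boost(R_i, R_j, p, q)` -/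
  | readAndBoost (i j : Fin r) (p q : Polynomial ℕ)
  /-- `write(R_i)` -/
  | write (i : Fin r)
  /-- `R_i ← w` for a fixed string `w` over the input alphabet -/
  | const (i : Fin r) (w : List Sig)
  /-- `R_i ← R_j` -/
  | copy (i j : Fin r)
  /-- `R_i ← F(R_{args 0}, …, R_{args (k-1)})` for an automatic function `F` -/
  | apply (i : Fin r) {k : ℕ} (F : AutFun Γ k) (args : Fin k → Fin r)
  /-- `goto(l)` -/
  | goto (l : ℕ)
  /-- `if F(R_{args 0}, …, R_{args (k-1)}) then goto(l)` for an automatic relation `F` -/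
  | ifGoto {k : ℕ} (F : AutRel Γ k) (args : Fin k → Fin r) (l : ℕ)
  /-- `halt` without a verdict -/
  | halt
  | haltAccept
  | haltReject

/-- A deterministic exponential-size padded automatic register machine with input alphabet `Sig`.
Its operations are the automatic functions and relations that occur in its program. -/
structure ExpDARM (Sig : Type) where
  /-- the machine alphabet -/
  Γ : Type
  finite : Finite Γ
  /-- the inclusion of the input alphabet into the machine alphabet -/
  incl : Sig ↪ Γ
  /-- the symbol of which the padding strings consist -/
  zero : Γ
  /-- the number of registers -/
  r : ℕ
  /-- the program; line numbers are positions in this list, starting with `0` -/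
  prog : List (Instr Γ Sig r)

/-- Whether a computation is still running, and how it ended otherwise. -/
inductive Status : Type
  | running
  | halted
  | accepted
  | rejected

namespace ExpDARM

variable {Sig : Type}

/-- A configuration: the status, the line to be executed next, the contents of the registers,
whether the input has been read, and the output written so far. -/
structure Config (M : ExpDARM Sig) where
  status : Status
  line : ℕ
  regs : Fin M.r → List M.Γ
  hasRead : Bool
  out : List M.Γ

/-- In the beginning all registers hold the empty string. -/
def init (M : ExpDARM Sig) : M.Config where
  status := .running
  line := 0
  regs := fun _ => []
  hasRead := false
  out := []

/-- The effect of one instruction on a running configuration, for the input `x` and for an adversary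
who makes the padding string `e` symbols longer than its guaranteed length
`2 ^ p(n) * q(n)`, `n = |x|`. Reading and boosting is possible only once: a computation which tries
to do it again is stuck and never halts. -/
noncomputable def exec (M : ExpDARM Sig) (x : List Sig) (e : ℕ) (c : M.Config) :
    Instr M.Γ Sig M.r → M.Config
  | .readAndBoost i j p q =>
      if c.hasRead then c
      else
        { c with
          line := c.line + 1
          hasRead := true
          regs := Function.update (Function.update c.regs i (x.map M.incl)) j
            (List.replicate (2 ^ p.eval x.length * q.eval x.length + e) M.zero) }
  | .write i => { c with line := c.line + 1, out := c.out ++ c.regs i }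
  | .const i w =>
      { c with line := c.line + 1, regs := Function.update c.regs i (w.map M.incl) }
  | .copy i j => { c with line := c.line + 1, regs := Function.update c.regs i (c.regs j) }
  | .apply i F args =>
      { c with
        line := c.line + 1
        regs := Function.update c.regs i (F.toFun fun a => c.regs (args a)) }
  | .goto l => { c with line := l }
  | .ifGoto F args l =>
      open Classical in
      { c with line := if F.holds (fun a => c.regs (args a)) then l else c.line + 1 }
  | .halt => { c with status := .halted }
  | .haltAccept => { c with status := .accepted }
  | .haltReject => { c with status := .rejected }

/-- One step: if the machine is still running, the current line is executed. Configurations that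
have halted do not change any more; neither does one whose line number is outside of the program,
which keeps running forever. -/
noncomputable def step (M : ExpDARM Sig) (x : List Sig) (e : ℕ) (c : M.Config) : M.Config :=
  match c.status with
  | .running =>
      match M.prog[c.line]? with
      | some I => M.exec x e c I
      | none => c
  | _ => c

/-- The status after `t` steps on input `x` with padding surplus `e`. -/
noncomputable def statusAfter (M : ExpDARM Sig) (x : List Sig) (e t : ℕ) : Status :=
  ((M.step x e)^[t] M.init).status

/-- `M` decides `L` within `t(n)` steps: whatever padding the adversary supplies, after `t(n)` steps
every input of length `n` in `L` has been accepted and every other one has been rejected. -/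
def DecidesIn (M : ExpDARM Sig) (L : Language Sig) (t : ℕ → ℕ) : Prop :=
  ∀ (x : List Sig) (e : ℕ),
    (x ∈ L → M.statusAfter x e (t x.length) = .accepted) ∧
    (x ∉ L → M.statusAfter x e (t x.length) = .rejected)

end ExpDARM

/-- `ExpDAL[f(n)]`: the languages over `Sig` that are decided by a deterministic exponential-size
padded automatic register machine in `O(f(n))` steps. -/
def ExpDAL {Sig : Type} (f : ℕ → ℕ) : Set (Language Sig) :=
  {L | ∃ (M : ExpDARM Sig) (t : ℕ → ℕ),
    Asymptotics.IsBigO Filter.atTop (fun n => (t n : ℝ)) (fun n => (f n : ℝ)) ∧ M.DecidesIn L t}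

/-! ### Quantified Boolean formulas and their coding -/

inductive Quantifier : Type
  | ex
  | all

/-- A literal on the variables `0, …, m-1`; `pos = true` means that it is not negated. -/
structure Lit (m : ℕ) where
  pos : Bool
  var : Fin m

/-- A clause is the disjunction of its literals. -/
abbrev Clause (m : ℕ) := List (Lit m)

/-- A closed quantified Boolean formula `Q_{m-1} v_{m-1} … Q_1 v_1 Q_0 v_0 φ`, whose inner part `φ`
is the conjunction of `clauses`. -/
structure QBF where
  m : ℕ
  quant : Fin m → Quantifier
  clauses : List (Clause m)

/-- The literal is true under the assignment `v`. -/
def Lit.Sat {m : ℕ} (l : Lit m) (v : Fin m → Bool) : Prop := v l.var = l.pos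

def Clause.Sat {m : ℕ} (c : Clause m) (v : Fin m → Bool) : Prop := ∃ l ∈ c, l.Sat v

/-- The clause `c` logically implies the clause `d`. -/
def Clause.Implies {m : ℕ} (c d : Clause m) : Prop :=
  ∀ v : Fin m → Bool, Clause.Sat c v → Clause.Sat d v

/-- Truth of `Q_{m-1} v_{m-1} … Q_0 v_0 φ`; the variable with the largest number is quantified
outermost. -/
def QuantHolds : (m : ℕ) → (Fin m → Quantifier) → ((Fin m → Bool) → Prop) → Prop
  | 0, _, φ => φ Fin.elim0
  | m + 1, Q, φ =>
      match Q (Fin.last m) with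
      | .ex => ∃ b : Bool, QuantHolds m (fun i => Q i.castSucc) fun v => φ (Fin.snoc v b)
      | .all => ∀ b : Bool, QuantHolds m (fun i => Q i.castSucc) fun v => φ (Fin.snoc v b)

namespace QBF

/-- The formula is true. -/
def IsTrue (φ : QBF) : Prop :=
  QuantHolds φ.m φ.quant fun v => ∀ c ∈ φ.clauses, Clause.Sat c v

/-- Every variable occurs in the inner part of the formula. -/
def AllOccur (φ : QBF) : Prop := ∀ i : Fin φ.m, ∃ c ∈ φ.clauses, ∃ l ∈ c, l.var = i

/-- No clause of the formula logically implies another one; clauses at different places of the list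
count as different, so that in particular there are no repetitions. -/
def RedundanceFree (φ : QBF) : Prop :=
  φ.clauses.Pairwise fun c d => ¬ Clause.Implies c d ∧ ¬ Clause.Implies d c

end QBF

/-- The alphabet of the coding: `∃ ∀ 0 1 [ ] + - _ , ;`. -/
inductive QSym : Type
  | ex
  | all
  | zero
  | one
  | lbrack
  | rbrack
  | plus
  | minus
  | underscore
  | comma
  | semicolon
  deriving DecidableEq

/-- The last `k` binary digits of `i`, most significant digit first. -/
def varName (k i : ℕ) : List QSym :=
  (List.range k).reverse.map fun j => if i.testBit j then .one else .zero

def Quantifier.code : Quantifier → QSym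
  | .ex => .ex
  | .all => .all

/-- For example `+01_` or `-01_`. -/
def Lit.code {m : ℕ} (k : ℕ) (l : Lit m) : List QSym :=
  (if l.pos then QSym.plus else QSym.minus) :: (varName k l.var ++ [.underscore])

/-- The literals of a clause, separated by commas. -/
def Clause.code {m : ℕ} (k : ℕ) (c : Clause m) : List QSym :=
  List.intercalate [QSym.comma] (c.map fun l => l.code k)

/-- The string that codes a formula, with variable names of `k` binary digits: the prefix with the
variables `m-1, …, 1, 0` in this order, then, in square brackets, the clauses separated by
semicolons. -/
def QBF.code (k : ℕ) (φ : QBF) : List QSym :=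
  ((List.finRange φ.m).reverse.flatMap fun i => (φ.quant i).code :: varName k i) ++
    [.lbrack] ++
    List.intercalate [QSym.semicolon] (φ.clauses.map fun c => Clause.code k c) ++ [.rbrack]

/-- `x` is a correct coding of the formula `φ`. -/
def IsCodingOf (x : List QSym) (φ : QBF) : Prop :=
  ∃ k : ℕ, φ.m ≤ 2 ^ k ∧ 2 ^ k < 2 * φ.m ∧ φ.AllOccur ∧ φ.RedundanceFree ∧ x = φ.code k

/-! ### Automatic relations by left derivatives -/

/-! The padding serves as a truth table. The low `k` binary digits of a position `t` name a
variable, and digit `k + i` of `t` is the value of variable `i`; so each block of `2 ^ k`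
consecutive positions holds one assignment. The machine consumes the coding from right to left, and
each symbol causes one Mealy transduction of the whole padding, an automatic operation. Constantly
many steps per symbol give linear time (`mem_ExpDAL_of_mealy`).

A transducer knows neither `k` nor its position, but it can count parities. If the positions with `2
^ j ∣ t + 1` are marked, the parity of the number of marks before `t` is digit `j` of `t`
(`par_dvd`), and keeping only the marks where this digit is one leaves those with `2 ^ (j + 1) ∣ t +
1` (`two_pow_succ_dvd`). Reading a variable name, lowest digit first, thus marks the block ends and
selects the place of this variable in every block (`acts_varName`). Literals mark the selected
places where they are satisfied, and the clause separators collect these marks at the block ends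
(`acts_innerCode`). The quantifier of variable `j` merges two neighbouring groups of `2 ^ (k + j)`
positions, which differ in the value of this variable, by a disjunction or a conjunction
(`acts_prefixCode_res`).

The values of the variables are themselves written by the quantifier prefix, which is reached only
after the inner part. Hence the coding is processed twice: the first pass provides the values, the
second evaluates the formula. A parity counter running through both passes singles out position `2 ^
(2 * n) - 1`, which exists for every choice of the padding and, as `k + m ≤ n`, ends a fully merged
group (`mem_ExpDAL_of_mealyStream`). -/

theorem conv_nil {Γ : Type} {k : ℕ} : conv (fun _ : Fin k => ([] : List Γ)) = [] := by
  simp [conv]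

theorem conv_of_ne_nil {Γ : Type} {k : ℕ} {w : Fin k → List Γ} (h : ∃ i, w i ≠ []) :
    conv w = (fun i => (w i).head?) :: conv (fun i => (w i).tail) := by
  have hs : (Finset.univ.sup fun i => (w i).length)
      = (Finset.univ.sup fun i => (w i).tail.length) + 1 := by
    apply le_antisymm
    · refine Finset.sup_le fun i _ => ?_
      have := Finset.le_sup (f := fun i => (w i).tail.length) (Finset.mem_univ i)
      simp only [List.length_tail] at this ⊢
      omega
    · obtain ⟨i, hi⟩ := h
      have h1 : 1 ≤ Finset.univ.sup fun i => (w i).length :=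
        le_trans (List.length_pos_iff.2 hi)
          (Finset.le_sup (f := fun i => (w i).length) (Finset.mem_univ i))
      have h2 : (Finset.univ.sup fun i => (w i).tail.length)
          ≤ (Finset.univ.sup fun i => (w i).length) - 1 := by
        refine Finset.sup_le fun j _ => ?_
        have := Finset.le_sup (f := fun i => (w i).length) (Finset.mem_univ j)
        simp only [List.length_tail]
        omega
      omega
  unfold conv
  rw [hs, List.range_succ_eq_map, List.map_cons, List.map_map]
  congr 1
  · funext i; simp [List.head?_eq_getElem?]
  · refine List.map_congr_left fun t _ => ?_
    funext i
    simp [List.getElem?_tail]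

theorem conv_eq_nil_iff {Γ : Type} {k : ℕ} {w : Fin k → List Γ} :
    conv w = [] ↔ w = fun _ => [] := by
  constructor
  · intro h
    by_contra hw
    have : ∃ i, w i ≠ [] := by
      by_contra! h'
      exact hw (funext h')
    rw [conv_of_ne_nil this] at h
    cases h
  · rintro rfl
    exact conv_nil

/-- A family of relations with finitely many indices which is closed under reading one column of the
convolution consists of automatic relations. -/
theorem isAutomaticRel_of_derivative {Γ σ : Type} [Finite σ] {k : ℕ}
    (R : σ → (Fin k → List Γ) → Prop) (δ : σ → (Fin k → Option Γ) → σ)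
    (hR : ∀ s w, (∃ i, w i ≠ []) →
      (R s w ↔ R (δ s fun i => (w i).head?) fun i => (w i).tail)) (s : σ) :
    IsAutomaticRel (R s) := by
  classical
  -- Besides the index of the current relation, a state records which strings have ended, since
  -- these must show only the filling symbol from then on. The state `none` rejects columns that
  -- occur in no convolution.
  let M : DFA (Fin k → Option Γ) (Option (σ × Set (Fin k))) :=
    { step := fun q a => q.bind fun p =>
        if (∃ i, a i ≠ none) ∧ ∀ i ∈ p.2, a i = none then some (δ p.1 a, {i | a i = none}) else none
      start := some (s, ∅)
      accept := {q | ∃ p, q = some p ∧ R p.1 fun _ => []} }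
  have hnone : ∀ u, M.evalFrom none u ∉ M.accept := by
    intro u
    induction u with
    | nil => rintro ⟨p, hp, -⟩; cases hp
    | cons a u ih => simpa [M] using ih
  have key : ∀ u s e, M.evalFrom (some (s, e)) u ∈ M.accept ↔
      ∃ w, (∀ i ∈ e, w i = []) ∧ R s w ∧ u = conv w := by
    intro u
    induction u with
    | nil =>
      intro s e
      constructor
      · rintro ⟨p, hp, h⟩
        cases hp
        exact ⟨fun _ => [], fun _ _ => rfl, h, conv_nil.symm⟩
      · rintro ⟨w, -, hw, h⟩
        rw [eq_comm, conv_eq_nil_iff] at h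
        subst h
        exact ⟨_, rfl, hw⟩
    | cons a u ih =>
      intro s e
      rw [DFA.evalFrom_cons]
      by_cases ha : (∃ i, a i ≠ none) ∧ ∀ i ∈ e, a i = none
      · have hst : M.step (some (s, e)) a = some (δ s a, {i | a i = none}) := by
          simp only [M, Option.bind_some]
          exact if_pos ha
        rw [hst, ih]
        constructor
        · rintro ⟨w, h0, hw, rfl⟩
          have h1 : (fun i => ((a i).toList ++ w i).head?) = a := by
            funext i
            cases hi : a i with
            | none => simp [h0 i hi]
            | some x => simp
          have h2 : (fun i => ((a i).toList ++ w i).tail) = w := by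
            funext i
            cases hi : a i with
            | none => simp [h0 i hi]
            | some x => simp
          have hne : ∃ i, (a i).toList ++ w i ≠ [] := by
            obtain ⟨i, hi⟩ := ha.1
            refine ⟨i, ?_⟩
            cases hx : a i with
            | none => exact absurd hx hi
            | some x => simp
          refine ⟨fun i => (a i).toList ++ w i, fun i hi => ?_, ?_, ?_⟩
          · simp [ha.2 i hi, h0 i (ha.2 i hi)]
          · rw [hR _ _ hne, h1, h2]; exact hw
          · rw [conv_of_ne_nil hne, h1, h2]
        · rintro ⟨w, h0, hw, h⟩
          have hne : ∃ i, w i ≠ [] := by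
            by_contra! h'
            rw [conv_eq_nil_iff.2 (funext h')] at h
            cases h
          rw [conv_of_ne_nil hne, List.cons.injEq] at h
          obtain ⟨rfl, rfl⟩ := h
          refine ⟨_, fun i hi => ?_, (hR _ _ hne).1 hw, rfl⟩
          have : w i = [] := List.head?_eq_none_iff.1 hi
          simp [this]
      · have hst : M.step (some (s, e)) a = none := by
          simp only [M, Option.bind_some]
          exact if_neg ha
        rw [hst]
        refine iff_of_false (hnone u) ?_
        rintro ⟨w, h0, hw, h⟩
        have hne : ∃ i, w i ≠ [] := by
          by_contra! h'
          rw [conv_eq_nil_iff.2 (funext h')] at h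
          cases h
        rw [conv_of_ne_nil hne, List.cons.injEq] at h
        obtain ⟨rfl, rfl⟩ := h
        refine ha ⟨?_, fun i hi => by simp [h0 i hi]⟩
        obtain ⟨i, hi⟩ := hne
        exact ⟨i, by simpa [List.head?_eq_none_iff] using hi⟩
  refine Language.isRegular_iff.2 ⟨_, Fintype.ofFinite _, M, ?_⟩
  ext u
  have := key u s ∅
  simp only [Set.mem_empty_iff_false, false_imp_iff, implies_true, true_and] at this
  exact this

/-! ### Some automatic functions and relations -/

/-- The letter-to-letter transduction with transition function `f`, started in the state `s`. -/
def mealy {σ Γ : Type} (f : σ → Γ → σ × Γ) : σ → List Γ → List Γ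
  | _, [] => []
  | s, c :: l => (f s c).2 :: mealy f (f s c).1 l

theorem isAutomaticFun_dropLast {Γ : Type} :
    IsAutomaticFun fun w : Fin 1 → List Γ => (w 0).dropLast := by
  classical
  -- State 0 is the start, 1 requires both strings to be used up, 2 is dead. State 3 follows a pair
  -- of equal symbols: the longer string must then go on, which excludes equality of the two
  -- strings.
  let R : Fin 4 → (Fin 2 → List Γ) → Prop := fun s w =>
    match s with
    | 0 => w 0 = (w 1).dropLast
    | 1 => w 0 = [] ∧ w 1 = []
    | 2 => False
    | 3 => w 1 ≠ [] ∧ w 0 = (w 1).dropLast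
  let δ : Fin 4 → (Fin 2 → Option Γ) → Fin 4 := fun s a =>
    match s with
    | 0 => if a 0 = a 1 then 3 else if a 0 = none then 1 else 2
    | 1 => 2
    | 2 => 2
    | 3 => if a 0 = a 1 then 3 else if a 0 = none then 1 else 2
  refine isAutomaticRel_of_derivative R δ ?_ 0
  intro s w hw
  obtain ⟨u, v, rfl⟩ : ∃ u v, w = ![u, v] :=
    ⟨w 0, w 1, by funext i; fin_cases i <;> rfl⟩
  have hw' : u ≠ [] ∨ v ≠ [] := by
    obtain ⟨i, hi⟩ := hw
    fin_cases i
    · exact .inl hi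
    · exact .inr hi
  match s with
  | 0 =>
    simp only [R, δ]
    rcases u with _ | ⟨a, u⟩ <;> rcases v with _ | ⟨b, _ | ⟨c, v⟩⟩
    · simp at hw'
    · simp
    · simp
    · simp
    · by_cases h : a = b <;> simp [h]
    · by_cases h : a = b <;> simp [h]
  | 1 =>
    simp only [R, δ, iff_false]
    rintro ⟨h0, h1⟩
    exact hw'.elim (· h0) (· h1)
  | 2 => simp [R, δ]
  | 3 =>
    simp only [R, δ]
    rcases u with _ | ⟨a, u⟩ <;> rcases v with _ | ⟨b, _ | ⟨c, v⟩⟩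
    · simp at hw'
    · simp
    · simp
    · simp
    · by_cases h : a = b <;> simp [h]
    · by_cases h : a = b <;> simp [h]

theorem isAutomaticRel_eq_nil {Γ : Type} :
    IsAutomaticRel fun w : Fin 1 → List Γ => w 0 = [] := by
  refine isAutomaticRel_of_derivative (σ := Bool) (fun s w => s = true ∧ w 0 = [])
    (fun _ _ => false) ?_ true |> fun h => by simpa using h
  rintro s w ⟨i, hi⟩
  obtain rfl : i = 0 := Subsingleton.elim _ _
  simp [hi]

/-- The first marked symbol of the string, if there is one, is good. -/
def firstMarked {Γ : Type} (mark good : Γ → Bool) (l : List Γ) : Prop :=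
  ∃ c, l.find? mark = some c ∧ good c = true

theorem isAutomaticRel_firstMarked {Γ : Type} (mark good : Γ → Bool) :
    IsAutomaticRel fun w : Fin 1 → List Γ => firstMarked mark good (w 0) := by
  let R : Option Bool → (Fin 1 → List Γ) → Prop := fun s w =>
    match s with
    | none => firstMarked mark good (w 0)
    | some b => b = true
  let δ : Option Bool → (Fin 1 → Option Γ) → Option Bool := fun s a =>
    match s, a 0 with
    | none, some c => if mark c then some (good c) else none
    | none, none => none
    | some b, _ => some b
  refine isAutomaticRel_of_derivative R δ ?_ none
  rintro s w ⟨i, hi⟩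
  obtain rfl : i = 0 := Subsingleton.elim _ _
  match s with
  | none =>
    simp only [R, δ]
    generalize w 0 = u at hi ⊢
    match u with
    | [] => simp at hi
    | c :: u => by_cases h : mark c = true <;> simp [h, firstMarked]
  | some b => simp [R, δ]

/-- The second string is transduced by the transducer that belongs to the last symbol of the first
string; it is not changed if the first string is empty. -/
def mealyLast {σ Γ : Type} (f : Γ → σ → Γ → σ × Γ) (s : σ) (y w : List Γ) : List Γ :=
  match y.getLast? with
  | none => w
  | some a => mealy (f a) s w

/-- The transducer to be used is known only when the first string ends, possibly after much of the
second has been read. The automaton therefore checks the output against all transducers in parallel,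
storing for each its state or the fact that it is refuted, together with the latest symbol of the
first string. -/
theorem isAutomaticFun_mealyLast {σ Γ : Type} [Finite σ] [Finite Γ] (f : Γ → σ → Γ → σ × Γ)
    (s₀ : σ) : IsAutomaticFun fun w : Fin 2 → List Γ => mealyLast f s₀ (w 0) (w 1) := by
  classical
  -- The index `none` is the identity transducer, for an empty first string.
  let g : Option Γ → σ → Γ → σ × Γ := fun a s c => a.elim (s, c) fun a => f a s c
  have hg : ∀ s w, mealy (g none) s w = w := by
    intro s w
    induction w with
    | nil => rfl
    | cons c w ih => simpa [mealy, g] using ih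
  let R : Option Γ × (Option Γ → Option σ) → (Fin 3 → List Γ) → Prop := fun q w =>
    ∃ s, q.2 ((w 1).getLast?.or q.1) = some s ∧ w 0 = mealy (g ((w 1).getLast?.or q.1)) s (w 2)
  let δ : Option Γ × (Option Γ → Option σ) → (Fin 3 → Option Γ) →
      Option Γ × (Option Γ → Option σ) := fun q a =>
    ((a 1).or q.1, fun b => (q.2 b).bind fun s =>
      match a 2 with
      | none => if a 0 = none then some s else none
      | some c => if a 0 = some (g b s c).2 then some (g b s c).1 else none)
  have main := isAutomaticRel_of_derivative R δ ?_ (none, fun _ => some s₀)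
  · unfold IsAutomaticFun
    convert main using 1
    funext v
    simp only [R, Option.or_none, Option.some.injEq, exists_eq_left', mealyLast]
    change (v 0 = match (v 1).getLast? with
      | none => v 2
      | some a => mealy (f a) s₀ (v 2)) = _
    cases h : (v 1).getLast? with
    | none => simp [hg]
    | some a => rfl
  · rintro ⟨l, q⟩ w -
    obtain ⟨o, u, v, rfl⟩ : ∃ o u v, w = ![o, u, v] :=
      ⟨w 0, w 1, w 2, by funext i; fin_cases i <;> rfl⟩
    have hl : u.tail.getLast?.or (u.head?.or l) = u.getLast?.or l := by
      match u with
      | [] => rfl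
      | [a] => rfl
      | a :: b :: u =>
        simp [List.getLast?_cons]
    change (∃ s, q (u.getLast?.or l) = some s ∧ o = mealy (g (u.getLast?.or l)) s v) ↔
      ∃ s, ((q (u.tail.getLast?.or (u.head?.or l))).bind fun s =>
        match v.head? with
        | none => if o.head? = none then some s else none
        | some c => if o.head? = some (g (u.tail.getLast?.or (u.head?.or l)) s c).2 then
            some (g (u.tail.getLast?.or (u.head?.or l)) s c).1 else none) = some s ∧
          o.tail = mealy (g (u.tail.getLast?.or (u.head?.or l))) s v.tail
    rw [hl]
    generalize u.getLast?.or l = b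
    cases q b with
    | none => simp
    | some s =>
      rcases o with _ | ⟨a, o⟩ <;> rcases v with _ | ⟨c, v⟩
      · simp [mealy]
      · simp [mealy]
      · simp [mealy]
      · by_cases h : a = (g b s c).2 <;> simp [mealy, h]

theorem mealyLast_append {σ Γ : Type} (f : Γ → σ → Γ → σ × Γ) (s : σ) (y : List Γ) (a : Γ)
    (w : List Γ) : mealyLast f s (y ++ [a]) w = mealy (f a) s w := by
  simp [mealyLast]
/-! ### A machine that transduces the padding by its input -/

theorem ExpDARM.step_eq {Sig : Type} {M : ExpDARM Sig} {x : List Sig} {e : ℕ} {c : M.Config}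
    {I : Instr M.Γ Sig M.r} (hs : c.status = .running) (hI : M.prog[c.line]? = some I) :
    M.step x e c = M.exec x e c I := by
  unfold ExpDARM.step
  rw [hs]
  simp only [hI]

section Machine

variable {Sig Γ σ : Type} [Finite Γ] [Finite σ]

/-- The machine reads the input from its last symbol to its first one, twice, and applies to the
padding string the transducers of the symbols read. -/
noncomputable def mealyMachine (incl : Sig ↪ Γ) (zero : Γ) (f : Γ → σ → Γ → σ × Γ) (s₀ : σ)
    (mark good : Γ → Bool) : ExpDARM Sig where
  Γ := Γ
  finite := inferInstance
  incl := incl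
  zero := zero
  r := 3
  prog :=
    -- Register 0 is the unread part of the input, register 1 the padding. Register 2 keeps a copy
    -- of the input for the second pass and is emptied when that pass begins.
    [.readAndBoost 0 1 (Polynomial.C 2 * Polynomial.X) 1,
      .copy 2 0,
      .ifGoto ⟨_, isAutomaticRel_eq_nil⟩ ![0] 6,
      .apply 1 ⟨_, isAutomaticFun_mealyLast f s₀⟩ ![0, 1],
      .apply 0 ⟨_, isAutomaticFun_dropLast⟩ ![0],
      .goto 2,
      .ifGoto ⟨_, isAutomaticRel_eq_nil⟩ ![2] 10,
      .copy 0 2,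
      .const 2 [],
      .goto 2,
      .ifGoto ⟨_, isAutomaticRel_firstMarked mark good⟩ ![1] 12,
      .haltReject,
      .haltAccept]

variable (incl : Sig ↪ Γ) (zero : Γ) (f : Γ → σ → Γ → σ × Γ) (s₀ : σ) (mark good : Γ → Bool)

/-- The configuration of the machine in the given line with the given registers. -/
def mealyMachine.cfg (l : ℕ) (a b c : List Γ) :
    (mealyMachine incl zero f s₀ mark good).Config where
  status := .running
  line := l
  regs := ![a, b, c]
  hasRead := true
  out := []

local notation "stp" => ExpDARM.step (mealyMachine incl zero f s₀ mark good)
local notation "cf" => mealyMachine.cfg incl zero f s₀ mark good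

theorem update_vec3_zero {α : Type} (a b c d : α) :
    Function.update ![a, b, c] 0 d = ![d, b, c] := by
  funext i; fin_cases i <;> rfl

theorem update_vec3_one {α : Type} (a b c d : α) :
    Function.update ![a, b, c] 1 d = ![a, d, c] := by
  funext i; fin_cases i <;> rfl

theorem update_vec3_two {α : Type} (a b c d : α) :
    Function.update ![a, b, c] 2 d = ![a, b, d] := by
  funext i; fin_cases i <;> rfl

namespace mealyMachine

theorem step_init (x : List Sig) (e : ℕ) :
    stp x e (mealyMachine incl zero f s₀ mark good).init =
      cf 1 (x.map incl) (List.replicate (2 ^ (2 * x.length) + e) zero) [] := by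
  rw [ExpDARM.step_eq rfl rfl]
  have h : 2 ^ (Polynomial.C 2 * Polynomial.X : Polynomial ℕ).eval x.length *
      (1 : Polynomial ℕ).eval x.length + e = 2 ^ (2 * x.length) + e := by simp
  simp only [ExpDARM.exec, ExpDARM.init, Bool.false_eq_true, if_false, cfg, h]
  congr 1
  funext i; fin_cases i <;> rfl

theorem step_one (x : List Sig) (e : ℕ) (a b c : List Γ) :
    stp x e (cf 1 a b c) = cf 2 a b a := by
  rw [ExpDARM.step_eq rfl rfl]
  exact congrArg (fun r => (⟨.running, _, r, true, []⟩ : ExpDARM.Config _)) (update_vec3_two a b c _)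

theorem step_two_nil (x : List Sig) (e : ℕ) (b c : List Γ) :
    stp x e (cf 2 [] b c) = cf 6 [] b c := by
  rw [ExpDARM.step_eq rfl rfl]
  exact congrArg (fun l => (⟨.running, l, _, true, []⟩ : ExpDARM.Config _)) (if_pos rfl)

theorem step_two (x : List Sig) (e : ℕ) (a b c : List Γ) (h : a ≠ []) :
    stp x e (cf 2 a b c) = cf 3 a b c := by
  rw [ExpDARM.step_eq rfl rfl]
  exact congrArg (fun l => (⟨.running, l, _, true, []⟩ : ExpDARM.Config _)) (if_neg h)

theorem step_three (x : List Sig) (e : ℕ) (a b c : List Γ) :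
    stp x e (cf 3 a b c) = cf 4 a (mealyLast f s₀ a b) c := by
  rw [ExpDARM.step_eq rfl rfl]
  exact congrArg (fun r => (⟨.running, _, r, true, []⟩ : ExpDARM.Config _)) (update_vec3_one a b c _)

theorem step_four (x : List Sig) (e : ℕ) (a b c : List Γ) :
    stp x e (cf 4 a b c) = cf 5 a.dropLast b c := by
  rw [ExpDARM.step_eq rfl rfl]
  exact congrArg (fun r => (⟨.running, _, r, true, []⟩ : ExpDARM.Config _)) (update_vec3_zero a b c _)

theorem step_five (x : List Sig) (e : ℕ) (a b c : List Γ) :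
    stp x e (cf 5 a b c) = cf 2 a b c := by
  rw [ExpDARM.step_eq rfl rfl]
  rfl

theorem step_six_nil (x : List Sig) (e : ℕ) (a b : List Γ) :
    stp x e (cf 6 a b []) = cf 10 a b [] := by
  rw [ExpDARM.step_eq rfl rfl]
  exact congrArg (fun l => (⟨.running, l, _, true, []⟩ : ExpDARM.Config _)) (if_pos rfl)

theorem step_six (x : List Sig) (e : ℕ) (a b c : List Γ) (h : c ≠ []) :
    stp x e (cf 6 a b c) = cf 7 a b c := by
  rw [ExpDARM.step_eq rfl rfl]
  exact congrArg (fun l => (⟨.running, l, _, true, []⟩ : ExpDARM.Config _)) (if_neg h)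

theorem step_seven (x : List Sig) (e : ℕ) (a b c : List Γ) :
    stp x e (cf 7 a b c) = cf 8 c b c := by
  rw [ExpDARM.step_eq rfl rfl]
  exact congrArg (fun r => (⟨.running, _, r, true, []⟩ : ExpDARM.Config _)) (update_vec3_zero a b c _)

theorem step_eight (x : List Sig) (e : ℕ) (a b c : List Γ) :
    stp x e (cf 8 a b c) = cf 9 a b [] := by
  rw [ExpDARM.step_eq rfl rfl]
  exact congrArg (fun r => (⟨.running, _, r, true, []⟩ : ExpDARM.Config _)) (update_vec3_two a b c _)

theorem step_nine (x : List Sig) (e : ℕ) (a b c : List Γ) :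
    stp x e (cf 9 a b c) = cf 2 a b c := by
  rw [ExpDARM.step_eq rfl rfl]
  rfl

theorem step_ten_of_firstMarked (x : List Sig) (e : ℕ) (a b c : List Γ)
    (h : firstMarked mark good b) : stp x e (cf 10 a b c) = cf 12 a b c := by
  rw [ExpDARM.step_eq rfl rfl]
  exact congrArg (fun l => (⟨.running, l, _, true, []⟩ : ExpDARM.Config _)) (if_pos h)

theorem step_ten_of_not_firstMarked (x : List Sig) (e : ℕ) (a b c : List Γ)
    (h : ¬ firstMarked mark good b) : stp x e (cf 10 a b c) = cf 11 a b c := by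
  rw [ExpDARM.step_eq rfl rfl]
  exact congrArg (fun l => (⟨.running, l, _, true, []⟩ : ExpDARM.Config _)) (if_neg h)

theorem step_eleven_status (x : List Sig) (e : ℕ) (a b c : List Γ) :
    (stp x e (cf 11 a b c)).status = .rejected := by
  rw [ExpDARM.step_eq rfl rfl]
  rfl

theorem step_twelve_status (x : List Sig) (e : ℕ) (a b c : List Γ) :
    (stp x e (cf 12 a b c)).status = .accepted := by
  rw [ExpDARM.step_eq rfl rfl]
  rfl

theorem iterate_loop (x : List Sig) (e : ℕ) (c : List Γ) (y : List Sig) : ∀ b : List Γ,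
    (stp x e)^[4 * y.length + 1] (cf 2 (y.map incl) b c) =
      cf 6 [] (y.foldr (fun a => mealy (f (incl a)) s₀) b) c := by
  -- Symbols are consumed from the end, four steps each; the additional step is the exit from the
  -- loop.
  induction y using List.reverseRecOn with
  | nil => intro b; exact step_two_nil incl zero f s₀ mark good x e b c
  | append_singleton y a ih =>
    intro b
    rw [List.length_append, List.length_singleton,
      show 4 * (y.length + 1) + 1 = (4 * y.length + 1) + 1 + 1 + 1 + 1 by ring,
      Function.iterate_succ_apply, Function.iterate_succ_apply, Function.iterate_succ_apply,
      Function.iterate_succ_apply, step_two _ _ _ _ _ _ _ _ _ _ _ (by simp), step_three,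
      step_four, step_five, List.map_append, List.map_singleton, List.dropLast_concat,
      mealyLast_append, ih, List.foldr_append]
    rfl

theorem exists_iterate_init (x : List Sig) (e : ℕ) : ∃ t ≤ 8 * x.length + 9,
    (stp x e)^[t] (mealyMachine incl zero f s₀ mark good).init =
      cf 10 [] (x.foldr (fun a => mealy (f (incl a)) s₀)
        (x.foldr (fun a => mealy (f (incl a)) s₀)
          (List.replicate (2 ^ (2 * x.length) + e) zero))) [] := by
  by_cases hx : x = []
  · subst hx
    refine ⟨4, by simp, ?_⟩
    simp only [Function.iterate_succ_apply, Function.iterate_zero_apply, step_init, step_one,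
      List.map_nil, step_two_nil, step_six_nil, List.foldr_nil]
  · refine ⟨1 + ((4 * x.length + 1) + 1 + 1 + 1 + 1 + ((4 * x.length + 1) + 1 + 1)), by omega, ?_⟩
    rw [show 1 + ((4 * x.length + 1) + 1 + 1 + 1 + 1 + ((4 * x.length + 1) + 1 + 1)) =
      1 + ((4 * x.length + 1) + (1 + 1 + 1 + 1 + ((4 * x.length + 1) + 1))) + 1 by ring,
      Function.iterate_succ_apply, step_init, Nat.add_comm 1, Function.iterate_succ_apply, step_one,
      Nat.add_comm (4 * x.length + 1), Function.iterate_add_apply, iterate_loop,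
      Nat.add_comm (1 + 1 + 1 + 1), Function.iterate_add_apply,
      Function.iterate_succ_apply _ (1 + 1 + 1), Function.iterate_succ_apply _ (1 + 1),
      Function.iterate_succ_apply _ 1, Function.iterate_one,
      step_six _ _ _ _ _ _ _ _ _ _ _ (by simpa using hx), step_seven, step_eight, step_nine,
      Function.iterate_succ_apply', iterate_loop, step_six_nil]

end mealyMachine

theorem ExpDARM.iterate_step_of_not_running (M : ExpDARM Sig) (x : List Sig) (e : ℕ) (c : M.Config)
    (h : c.status ≠ .running) (t : ℕ) : (M.step x e)^[t] c = c := by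
  induction t with
  | zero => rfl
  | succ t ih =>
    rw [Function.iterate_succ_apply', ih]
    unfold ExpDARM.step
    split
    · contradiction
    · rfl

theorem mem_ExpDAL_of_mealy (L : Language Sig)
    (hL : ∀ (x : List Sig) (e : ℕ), x ∈ L ↔ firstMarked mark good
      (x.foldr (fun a => mealy (f (incl a)) s₀) (x.foldr (fun a => mealy (f (incl a)) s₀)
          (List.replicate (2 ^ (2 * x.length) + e) zero)))) :
    L ∈ ExpDAL (fun n => n) := by
  have key : ∀ (x : List Sig) (e : ℕ) (v : Status), v ≠ .running →
      (∀ a b c, (firstMarked mark good b ↔ x ∈ L) →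
        (stp x e (stp x e (cf 10 a b c))).status = v) →
      (mealyMachine incl zero f s₀ mark good).statusAfter x e (11 * x.length + 11) = v := by
    intro x e v hv h
    obtain ⟨t, ht, h0⟩ := mealyMachine.exists_iterate_init incl zero f s₀ mark good x e
    have h1 := h [] _ [] (hL x e).symm
    obtain ⟨d, hd⟩ : ∃ d, 11 * x.length + 11 = d + (1 + 1 + t) :=
      ⟨11 * x.length + 11 - (1 + 1 + t), by omega⟩
    unfold ExpDARM.statusAfter
    rw [hd, Function.iterate_add_apply, Function.iterate_add_apply _ (1 + 1), h0,
      Function.iterate_succ_apply, Function.iterate_one,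
      ExpDARM.iterate_step_of_not_running _ _ _ _ (by rw [h1]; exact hv), h1]
  refine ⟨mealyMachine incl zero f s₀ mark good, fun n => 11 * n + 11, ?_, fun x e => ⟨?_, ?_⟩⟩
  · refine Asymptotics.IsBigO.of_bound 22 ?_
    filter_upwards [Filter.eventually_ge_atTop 1] with n hn
    have : (1 : ℝ) ≤ n := by exact_mod_cast hn
    rw [Real.norm_of_nonneg (by positivity), Real.norm_of_nonneg (by positivity)]
    push_cast
    linarith
  · intro hx
    refine key x e _ (by simp) fun a b c h => ?_
    rw [mealyMachine.step_ten_of_firstMarked _ _ _ _ _ _ _ _ _ _ _ (h.2 hx),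
      mealyMachine.step_twelve_status]
  · intro hx
    refine key x e _ (by simp) fun a b c h => ?_
    rw [mealyMachine.step_ten_of_not_firstMarked _ _ _ _ _ _ _ _ _ _ _ (mt h.1 hx),
      mealyMachine.step_eleven_status]

end Machine
/-! ### Transductions of infinite strings -/

/-- The states that a transducer goes through on the infinite string `w`. -/
def mealyState {σ Γ : Type} (f : σ → Γ → σ × Γ) (s : σ) (w : ℕ → Γ) : ℕ → σ
  | 0 => s
  | t + 1 => (f (mealyState f s w t) (w t)).1

/-- The transduction of the infinite string `w`. -/
def mealyStream {σ Γ : Type} (f : σ → Γ → σ × Γ) (s : σ) (w : ℕ → Γ) (t : ℕ) : Γ :=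
  (f (mealyState f s w t) (w t)).2

theorem mealyState_succ {σ Γ : Type} (f : σ → Γ → σ × Γ) (s : σ) (w : ℕ → Γ) (t : ℕ) :
    mealyState f s w (t + 1) = mealyState f (f s (w 0)).1 (fun t => w (t + 1)) t := by
  induction t with
  | zero => rfl
  | succ t ih => rw [mealyState, ih]; rfl

/-- An output symbol depends only on the input up to its position, so the length of the padding can
be ignored. -/
theorem mealy_map_range {σ Γ : Type} (f : σ → Γ → σ × Γ) (n : ℕ) : ∀ (s : σ) (w : ℕ → Γ),
    mealy f s ((List.range n).map w) = (List.range n).map (mealyStream f s w) := by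
  induction n with
  | zero => intro s w; rfl
  | succ n ih =>
    intro s w
    simp only [List.range_succ_eq_map, List.map_cons, List.map_map, mealy]
    congr 1
    rw [show w ∘ Nat.succ = fun t => w (t + 1) from rfl, ih]
    refine List.map_congr_left fun t _ => ?_
    simp only [mealyStream, Function.comp, Nat.succ_eq_add_one, mealyState_succ]

/-! ### Counting by parities -/

/-- The parity of the number of marks before the given position. -/
def par (Z : ℕ → Bool) : ℕ → Bool
  | 0 => false
  | t + 1 => xor (par Z t) (Z t)

/-- There are `t / 2 ^ j` marks before `t`, and the parity of this quotient is digit `j`. -/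
theorem par_dvd (j t : ℕ) : par (fun t => decide (2 ^ j ∣ t + 1)) t = t.testBit j := by
  induction t with
  | zero => simp [par]
  | succ t ih =>
    rw [par, ih, Nat.testBit_eq_decide_div_mod_eq, Nat.testBit_eq_decide_div_mod_eq, Nat.succ_div]
    by_cases h : 2 ^ j ∣ t + 1
    · rcases Nat.mod_two_eq_zero_or_one (t / 2 ^ j) with h2 | h2 <;> simp [h, h2, Nat.add_mod]
    · simp [h]

/-- If `t + 1 = 2 ^ j * (d + 1)`, then `t / 2 ^ j = d`, and `d + 1` is even exactly when `d` is odd.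
-/
theorem two_pow_succ_dvd (j t : ℕ) :
    2 ^ (j + 1) ∣ t + 1 ↔ 2 ^ j ∣ t + 1 ∧ t.testBit j = true := by
  have key : 2 ^ j ∣ t + 1 → (2 ^ (j + 1) ∣ t + 1 ↔ t.testBit j = true) := by
    rintro ⟨c, hc⟩
    have hq : 0 < 2 ^ j := by positivity
    obtain ⟨d, rfl⟩ : ∃ d, c = d + 1 := ⟨c - 1, by
      have : c ≠ 0 := by rintro rfl; simp at hc
      omega⟩
    have ht : t = 2 ^ j - 1 + d * 2 ^ j := by
      have : 2 ^ j * (d + 1) = d * 2 ^ j + 2 ^ j := by ring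
      omega
    have hd : t / 2 ^ j = d := by
      rw [ht, Nat.add_mul_div_right _ _ hq, Nat.div_eq_of_lt (by omega), zero_add]
    rw [Nat.testBit_eq_decide_div_mod_eq, hd, hc, pow_succ, Nat.mul_dvd_mul_iff_left hq,
      decide_eq_true_iff]
    omega
  constructor
  · intro h
    have h' : 2 ^ j ∣ t + 1 := dvd_trans (pow_dvd_pow 2 (Nat.le_succ j)) h
    exact ⟨h', (key h').1 h⟩
  · rintro ⟨h1, h2⟩
    exact (key h1).2 h2

theorem decide_two_pow_succ_dvd (j t : ℕ) :
    (decide (2 ^ j ∣ t + 1) && t.testBit j) = decide (2 ^ (j + 1) ∣ t + 1) := by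
  rw [Bool.eq_iff_iff]
  simp [two_pow_succ_dvd]

/-! ### Languages decided by transductions of the padding -/

section Clock

variable {Sig T σ : Type}

/-- The transducers `g`, together with a track that counts the transductions. -/
def clocked (g : Sig → σ → T → σ × T) (a : Option Sig × T × Bool) (s : σ × Bool)
    (c : Option Sig × T × Bool) : (σ × Bool) × (Option Sig × T × Bool) :=
  match a.1 with
  | none => (s, c)
  | some b => (((g b s.1 c.2.1).1, xor s.2 c.2.2), (c.1, (g b s.1 c.2.1).2, c.2.2 && s.2))

theorem mealyStream_clocked (g : Sig → σ → T → σ × T) (s : σ) (a : Sig) (z : T) (b : Bool)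
    (w : ℕ → T) (j : ℕ) :
    mealyStream (clocked g (some a, z, b)) (s, false)
        (fun t => (none, w t, decide (2 ^ j ∣ t + 1))) =
      fun t => (none, mealyStream (g a) s w t, decide (2 ^ (j + 1) ∣ t + 1)) := by
  have h : ∀ t, mealyState (clocked g (some a, z, b)) (s, false)
        (fun t => (none, w t, decide (2 ^ j ∣ t + 1))) t =
      (mealyState (g a) s w t, par (fun t => decide (2 ^ j ∣ t + 1)) t) := by
    intro t
    induction t with
    | zero => rfl
    | succ t ih => rw [mealyState, ih]; rfl
  funext t
  rw [mealyStream, h, par_dvd]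
  simp only [clocked, decide_two_pow_succ_dvd]
  rfl

theorem foldr_clocked (g : Sig → σ → T → σ × T) (s : σ) (z : T) (b : Bool) (ℓ : ℕ) (w : ℕ → T)
    (j : ℕ) (x : List Sig) :
    x.foldr (fun a => mealy (clocked g (some a, z, b)) (s, false))
        ((List.range ℓ).map fun t => (none, w t, decide (2 ^ j ∣ t + 1))) =
      (List.range ℓ).map fun t => (none, x.foldr (fun a => mealyStream (g a) s) w t,
        decide (2 ^ (j + x.length) ∣ t + 1)) := by
  induction x with
  | nil => rfl
  | cons a x ih =>
    rw [List.foldr_cons, ih, mealy_map_range, mealyStream_clocked]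
    rfl

theorem mem_ExpDAL_of_mealyStream [Finite Sig] [Finite T] [Finite σ] (g : Sig → σ → T → σ × T)
    (s : σ) (z : T) (good : T → Bool) (L : Language Sig)
    (hL : ∀ x : List Sig, x ∈ L ↔ good (x.foldr (fun a => mealyStream (g a) s)
      (x.foldr (fun a => mealyStream (g a) s) fun _ => z) (2 ^ (2 * x.length) - 1)) = true) :
    L ∈ ExpDAL (fun n => n) := by
  refine mem_ExpDAL_of_mealy (Γ := Option Sig × T × Bool) 
    ⟨fun a => (some a, z, true), fun a b h => Option.some.inj (congrArg Prod.fst h)⟩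
    (none, z, true) (clocked g) (s, false) (fun c => c.2.2) (fun c => good c.2.1) L fun x e => ?_
  rw [hL]
  change _ ↔ firstMarked _ _
    (x.foldr (fun a => mealy (clocked g (some a, z, true)) (s, false))
      (x.foldr (fun a => mealy (clocked g (some a, z, true)) (s, false)) _))
  have h0 : List.replicate (2 ^ (2 * x.length) + e) ((none, z, true) : Option Sig × T × Bool) =
      (List.range (2 ^ (2 * x.length) + e)).map
        fun t => (none, z, decide (2 ^ 0 ∣ t + 1)) := by
    simp
  rw [h0, foldr_clocked, foldr_clocked]
  have hp : 0 < 2 ^ (2 * x.length) := by positivity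
  -- After `2 * x.length` transductions the first clock mark is at this position, independently of
  -- the surplus `e`.
  have h1 : (List.range (2 ^ (2 * x.length) + e)).find?
      (fun t => decide (2 ^ (0 + x.length + x.length) ∣ t + 1)) =
        some (2 ^ (2 * x.length) - 1) := by
    rw [List.find?_range_eq_some, show 0 + x.length + x.length = 2 * x.length by ring]
    refine ⟨?_, ?_, ?_⟩
    · rw [Nat.sub_add_cancel hp]; simp
    · rw [List.mem_range]; omega
    · intro t ht
      simp only [Bool.not_eq_eq_eq_not, Bool.not_true, decide_eq_false_iff_not]
      exact Nat.not_dvd_of_pos_of_lt (by omega) (by omega)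
  simp only [firstMarked, List.find?_map, Function.comp_def, h1, Option.map_some,
    Option.some.injEq, exists_eq_left']

end Clock
/-! ### The tracks of the padding string -/

/-- The bits at one position `t` of the padding string. The string is divided into blocks; the
position in the block stands for a variable, the number of the block for an assignment.
`ends` is used for counting the digits of the name that is read and marks the ends of the blocks
afterwards; `sel` marks the variable with this name; `val` is its value under the assignment;
`sat` marks the literals that satisfy the clause that is read; `res` is, at the end of the block,
the value of the formula, and `grp` marks the ends of the groups of blocks that have the same
assignment of the variables that are not yet eliminated. -/
structure Track : Type where
  ends : Bool
  sel : Bool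
  val : Bool
  sat : Bool
  res : Bool
  grp : Bool

instance : Finite Track :=
  Finite.of_injective (fun c => (c.ends, c.sel, c.val, c.sat, c.res, c.grp)) fun c d h => by
    cases c; cases d; simpa using h

/-- What the transducers remember: the parities of the numbers of `ends` and `grp`, whether `sat`
occurred in the block, and the last `res` at a `grp`. -/
structure Memory : Type where
  endsPar : Bool
  grpPar : Bool
  someSat : Bool
  lastRes : Bool

instance : Finite Memory :=
  Finite.of_injective (fun c => (c.endsPar, c.grpPar, c.someSat, c.lastRes)) fun c d h => by
    cases c; cases d; simpa using h

/-- The memory covers only earlier positions, and a block end clears `someSat`. A symbol evaluated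
at a block end must therefore add the `sat` of that position itself. -/
def Memory.next (s : Memory) (c : Track) : Memory where
  endsPar := xor s.endsPar c.ends
  grpPar := xor s.grpPar c.grp
  someSat := if c.ends then false else s.someSat || c.sat
  lastRes := if c.grp then c.res else s.lastRes

/-- The effect of the symbols of a coding, which are read from the right to the left. -/
def QSym.transduce (s : Memory) (c : Track) : QSym → Track
  | .rbrack => { c with res := true, sat := false }
  | .underscore => { c with ends := true, sel := true }
  | .zero => { c with ends := c.ends && s.endsPar, sel := c.sel && (s.endsPar == false) }
  | .one => { c with ends := c.ends && s.endsPar, sel := c.sel && (s.endsPar == true) }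
  | .plus => { c with sat := c.sat || (c.sel && (c.val == true)) }
  | .minus => { c with sat := c.sat || (c.sel && (c.val == false)) }
  | .comma => c
  | .semicolon => { c with res := c.res && (s.someSat || c.sat), sat := false }
  | .lbrack =>
    { c with
      res := c.res && (s.someSat || c.sat), sat := false, grp := c.ends, ends := true, sel := true }
  | .ex =>
    { c with
      val := c.val || (c.sel && s.grpPar)
      res := if c.grp && s.grpPar then s.lastRes || c.res else c.res
      grp := c.grp && s.grpPar, ends := true, sel := true }
  | .all =>
    { c with
      val := c.val || (c.sel && s.grpPar)
      res := if c.grp && s.grpPar then s.lastRes && c.res else c.res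
      grp := c.grp && s.grpPar, ends := true, sel := true }

/-- Whether there is a `D` before the given position and after the last `Z` before it. -/
def someSince (Z D : ℕ → Bool) : ℕ → Bool
  | 0 => false
  | t + 1 => if Z t then false else someSince Z D t || D t

/-- The value of `E` at the last `B` before the given position. -/
def lastAt (B E : ℕ → Bool) : ℕ → Bool
  | 0 => false
  | t + 1 => if B t then E t else lastAt B E t

/-- The memory of the transducers at the given position. -/
def memory (w : ℕ → Track) (t : ℕ) : Memory where
  endsPar := par (fun t => (w t).ends) t
  grpPar := par (fun t => (w t).grp) t
  someSat := someSince (fun t => (w t).ends) (fun t => (w t).sat) t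
  lastRes := lastAt (fun t => (w t).grp) (fun t => (w t).res) t

def Memory.start : Memory := ⟨false, false, false, false⟩

/-- The effect of a symbol on the infinite padding string. -/
def QSym.act (a : QSym) (w : ℕ → Track) (t : ℕ) : Track := a.transduce (memory w t) (w t)

theorem mealyStream_eq_act (a : QSym) :
    mealyStream (fun s c => (Memory.next s c, a.transduce s c)) Memory.start = a.act := by
  funext w t
  have h : ∀ t, mealyState (fun s c => (Memory.next s c, a.transduce s c)) Memory.start w t =
      memory w t := by
    intro t
    induction t with
    | zero => rfl
    | succ t ih => rw [mealyState, ih]; rfl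
  rw [mealyStream, h]
  rfl

/-- The effect of a string. -/
def acts (l : List QSym) (w : ℕ → Track) : ℕ → Track := l.foldr QSym.act w

theorem acts_append (l l' : List QSym) (w : ℕ → Track) : acts (l ++ l') w = acts l (acts l' w) :=
  List.foldr_append

theorem acts_cons (a : QSym) (l : List QSym) (w : ℕ → Track) :
    acts (a :: l) w = a.act (acts l w) := rfl

theorem someSince_dvd (k : ℕ) (D : ℕ → Bool) (t : ℕ) :
    someSince (fun t => decide (2 ^ k ∣ t + 1)) D t = true ↔
      ∃ s < t, s / 2 ^ k = t / 2 ^ k ∧ D s = true := by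
  induction t with
  | zero => simp [someSince]
  | succ t ih =>
    rw [someSince, Nat.succ_div]
    by_cases h : 2 ^ k ∣ t + 1
    · simp only [h, decide_true, if_true, Bool.false_eq_true, false_iff]
      rintro ⟨s, hs, h1, -⟩
      have := Nat.div_le_div_right (c := 2 ^ k) (Nat.le_of_lt_succ hs)
      omega
    · simp only [h, decide_false, Bool.false_eq_true, if_false, Bool.or_eq_true, ih, add_zero]
      constructor
      · rintro (⟨s, hs, h1, h2⟩ | h2)
        · exact ⟨s, by omega, h1, h2⟩
        · exact ⟨t, by omega, rfl, h2⟩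
      · rintro ⟨s, hs, h1, h2⟩
        rcases Nat.lt_succ_iff_lt_or_eq.1 hs with h3 | rfl
        · exact .inl ⟨s, h3, h1, h2⟩
        · exact .inr h2

theorem someSince_of_forall_false (Z D : ℕ → Bool) (hD : ∀ t, D t = false) (t : ℕ) :
    someSince Z D t = false := by
  induction t with
  | zero => rfl
  | succ t ih => simp [someSince, ih, hD]

/-- The hypothesis `ht` says that some mark precedes `t`; otherwise the default value `false` would
be returned. -/
theorem lastAt_dvd (j : ℕ) (E : ℕ → Bool) (t : ℕ) (ht : 1 ≤ t / 2 ^ j) :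
    lastAt (fun t => decide (2 ^ j ∣ t + 1)) E t = E (t / 2 ^ j * 2 ^ j - 1) := by
  induction t with
  | zero => simp at ht
  | succ t ih =>
    rw [Nat.succ_div] at ht ⊢
    rw [lastAt]
    by_cases h : 2 ^ j ∣ t + 1
    · simp only [h, decide_true, if_true]
      have := Nat.succ_div_of_dvd h
      rw [← this, Nat.div_mul_cancel h, Nat.add_sub_cancel]
    · simp only [h, decide_false, Bool.false_eq_true, if_false, add_zero] at ht ⊢
      exact ih ht

theorem mod_two_pow_succ_eq_iff (k t i : ℕ) :
    t % 2 ^ (k + 1) = i % 2 ^ (k + 1) ↔ t % 2 ^ k = i % 2 ^ k ∧ t.testBit k = i.testBit k := by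
  rw [Nat.mod_pow_succ, Nat.mod_pow_succ, Nat.testBit_eq_decide_div_mod_eq,
    Nat.testBit_eq_decide_div_mod_eq]
  have h1 := Nat.mod_lt t (y := 2 ^ k) (by positivity)
  have h2 := Nat.mod_lt i (y := 2 ^ k) (by positivity)
  rcases Nat.mod_two_eq_zero_or_one (t / 2 ^ k) with h3 | h3 <;>
    rcases Nat.mod_two_eq_zero_or_one (i / 2 ^ k) with h4 | h4 <;> simp [h3, h4] <;> omega

theorem varName_succ (k i : ℕ) :
    varName (k + 1) i = (if i.testBit k then QSym.one else QSym.zero) :: varName k i := by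
  simp [varName, List.range_succ]

theorem acts_varName (k i : ℕ) (w : ℕ → Track) (he : ∀ t, (w t).ends = true)
    (hs : ∀ t, (w t).sel = true) (t : ℕ) :
    acts (varName k i) w t =
      { w t with ends := decide (2 ^ k ∣ t + 1), sel := decide (t % 2 ^ k = i % 2 ^ k) } := by
  induction k generalizing t with
  | zero =>
    have := he t
    have := hs t
    simp only [varName, acts, List.range_zero, List.reverse_nil, List.map_nil, List.foldr_nil,
      pow_zero, one_dvd, Nat.mod_one, decide_true]
    cases h : w t
    simp_all
  | succ k ih =>
    have hp : (memory (acts (varName k i) w) t).endsPar = t.testBit k := by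
      simp only [memory, ih, par_dvd]
    have hb : ∀ b : Bool, (if b then QSym.one else QSym.zero).act (acts (varName k i) w) t =
        { w t with
          ends := decide (2 ^ k ∣ t + 1) && t.testBit k
          sel := decide (t % 2 ^ k = i % 2 ^ k) && (t.testBit k == b) } := by
      intro b
      cases b <;> simp only [Bool.false_eq_true, if_true, if_false, QSym.act, QSym.transduce, hp] <;>
        rw [ih]
    have hsel : (decide (t % 2 ^ k = i % 2 ^ k) && (t.testBit k == i.testBit k)) =
        decide (t % 2 ^ (k + 1) = i % 2 ^ (k + 1)) := by
      rw [Bool.eq_iff_iff]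
      simp [mod_two_pow_succ_eq_iff]
    rw [varName_succ, acts_cons, hb, decide_two_pow_succ_dvd, hsel]

theorem acts_litCode {m : ℕ} (k : ℕ) (l : Lit m) (w : ℕ → Track) (t : ℕ) :
    acts (l.code k) w t =
      { w t with
        ends := decide (2 ^ k ∣ t + 1)
        sel := decide (t % 2 ^ k = l.var % 2 ^ k)
        sat := (w t).sat || (decide (t % 2 ^ k = l.var % 2 ^ k) && ((w t).val == l.pos)) } := by
  have h := acts_varName k l.var (QSym.act .underscore w) (fun _ => rfl) (fun _ => rfl)
  rw [Lit.code, acts_cons, acts_append]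
  change QSym.act _ (acts (varName k l.var) (QSym.act .underscore w)) t = _
  cases hp : l.pos <;> simp only [Bool.false_eq_true, if_true, if_false, QSym.act, QSym.transduce] <;>
    rw [h] <;> rfl

theorem acts_intercalate_comma (ls : List (List QSym)) (w : ℕ → Track) :
    acts (List.intercalate [QSym.comma] ls) w = acts ls.flatten w := by
  induction ls with
  | nil => simp
  | cons l ls ih =>
    cases ls with
    | nil => simp
    | cons l' ls =>
      rw [List.intercalate_cons_cons, List.flatten_cons, acts_append, acts_append, acts_append, ih]
      rfl

theorem acts_clauseCode {m : ℕ} (k : ℕ) (hm : m ≤ 2 ^ k) (c : Clause m) (w : ℕ → Track) :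
    (∀ t, (acts (c.code k) w t).val = (w t).val ∧ (acts (c.code k) w t).res = (w t).res ∧
      (acts (c.code k) w t).grp = (w t).grp ∧
      ((acts (c.code k) w t).sat = true ↔
        (w t).sat = true ∨ ∃ l ∈ c, t % 2 ^ k = l.var ∧ (w t).val = l.pos)) ∧
    (c = [] → acts (c.code k) w = w) ∧
    (c ≠ [] → ∀ t, (acts (c.code k) w t).ends = decide (2 ^ k ∣ t + 1)) := by
  rw [Clause.code, acts_intercalate_comma]
  induction c with
  | nil => simp [acts]
  | cons l c ih =>
    have hl : (l.var : ℕ) % 2 ^ k = l.var := Nat.mod_eq_of_lt (lt_of_lt_of_le l.var.2 hm)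
    rw [List.map_cons, List.flatten_cons, acts_append]
    refine ⟨fun t => ?_, by simp, fun _ t => ?_⟩
    · obtain ⟨h1, h2, h3, h4⟩ := ih.1 t
      rw [acts_litCode, hl]
      refine ⟨h1, h2, h3, ?_⟩
      simp only [Bool.or_eq_true, Bool.and_eq_true, decide_eq_true_iff, beq_iff_eq, h4, h1,
        List.exists_mem_cons_iff]
      rw [or_assoc]
      exact or_congr_right or_comm
    · rw [acts_litCode]
/-! ### The evaluation of the inner part -/

/-- The track `val` contains the values of the variables `0, …, m-1`. -/
def HasValues (k m : ℕ) (w : ℕ → Track) : Prop :=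
  ∀ t, t % 2 ^ k < m → (w t).val = t.testBit (k + t % 2 ^ k)

/-- The assignment of the block that contains the given position. -/
def blockAssignment (k t i : ℕ) : Bool := t.testBit (k + i)

theorem blockAssignment_congr {k s t : ℕ} (h : s / 2 ^ k = t / 2 ^ k) :
    blockAssignment k s = blockAssignment k t := by
  funext i
  rw [blockAssignment, blockAssignment, Nat.add_comm, ← Nat.testBit_div_two_pow,
    ← Nat.testBit_div_two_pow, h]

/-- Each clause, preceded by a semicolon. -/
def clausesCode {m : ℕ} (k : ℕ) (cs : List (Clause m)) : List QSym :=
  cs.flatMap fun c => QSym.semicolon :: Clause.code k c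

theorem semicolon_act_res {m : ℕ} {k : ℕ} (hm : m ≤ 2 ^ k) (c : Clause m) (w : ℕ → Track)
    (hw : ∀ t, (w t).sat = false) (hv : HasValues k m w) (t : ℕ) (ht : 2 ^ k ∣ t + 1) :
    (QSym.act .semicolon (acts (c.code k) w) t).res = true ↔
      (w t).res = true ∧ Clause.Sat c fun i => blockAssignment k t i := by
  obtain ⟨h1, h2, h3⟩ := acts_clauseCode k hm c w
  simp only [QSym.act, QSym.transduce, (h1 t).2.1, Bool.and_eq_true, memory]
  refine and_congr_right fun _ => ?_
  -- An empty clause provides no block ends, but as `sat` is nowhere set, it is evaluated to `false`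
  -- anyway.
  by_cases hc : c = []
  · rw [h2 hc]
    rw [someSince_of_forall_false _ _ hw, hw]
    simp [hc, Clause.Sat]
  · simp only [h3 hc, Bool.or_eq_true, someSince_dvd, (h1 _).2.2.2, hw, Bool.false_eq_true,
      false_or]
    have hq : 0 < 2 ^ k := by positivity
    have hmod : ∀ s, s / 2 ^ k = t / 2 ^ k → ∀ l : Lit m, s % 2 ^ k = l.var →
        ((w s).val = l.pos ↔ l.Sat fun i => blockAssignment k t i) := by
      intro s hs l hl
      rw [hv s (by rw [hl]; exact l.var.2), Lit.Sat, ← blockAssignment_congr hs, blockAssignment,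
        hl]
    constructor
    · rintro (⟨s, -, hs, l, hlc, h, h'⟩ | ⟨l, hlc, h, h'⟩)
      · exact ⟨l, hlc, (hmod s hs l h).1 h'⟩
      · exact ⟨l, hlc, (hmod t rfl l h).1 h'⟩
    · rintro ⟨l, hlc, hl⟩
      have hlt : (l.var : ℕ) < 2 ^ k := lt_of_lt_of_le l.var.2 hm
      -- The witness is the place of the variable of `l` in the block that ends at `t`.
      have hs : (t / 2 ^ k * 2 ^ k + l.var) / 2 ^ k = t / 2 ^ k := by
        rw [Nat.add_comm, Nat.add_mul_div_right _ _ hq, Nat.div_eq_of_lt hlt, zero_add]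
      have hs' : (t / 2 ^ k * 2 ^ k + l.var) % 2 ^ k = l.var := by
        rw [Nat.add_comm, Nat.add_mul_mod_self_right, Nat.mod_eq_of_lt hlt]
      have hle : t / 2 ^ k * 2 ^ k + l.var ≤ t := by
        have h4 := Nat.succ_div_of_dvd ht
        have h5 := Nat.div_mul_cancel ht
        rw [h4, Nat.add_mul] at h5
        omega
      have hval := (hmod _ hs l hs').2 hl
      rcases Nat.lt_or_eq_of_le hle with h4 | h4
      · exact .inl ⟨_, h4, hs, l, hlc, hs', hval⟩
      · rw [h4] at hs' hval
        exact .inr ⟨l, hlc, hs', hval⟩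

theorem acts_clausesCode {m : ℕ} {k : ℕ} (hm : m ≤ 2 ^ k) (cs : List (Clause m)) (w : ℕ → Track)
    (hw : ∀ t, (w t).sat = false) :
    (∀ t, (acts (clausesCode k cs) w t).sat = false ∧
      (acts (clausesCode k cs) w t).val = (w t).val) ∧
    ((∃ c ∈ cs, c ≠ []) → ∀ t, (acts (clausesCode k cs) w t).ends = decide (2 ^ k ∣ t + 1)) ∧
    (HasValues k m w → ∀ t, 2 ^ k ∣ t + 1 → ((acts (clausesCode k cs) w t).res = true ↔
      (w t).res = true ∧ ∀ c ∈ cs, Clause.Sat c fun i => blockAssignment k t i)) := by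
  induction cs with
  | nil => simp [acts, clausesCode, hw]
  | cons c cs ih =>
    obtain ⟨i1, i2, i3⟩ := ih
    rw [clausesCode, List.flatMap_cons, List.cons_append, acts_cons, acts_append,
      ← clausesCode]
    obtain ⟨h1, h2, h3⟩ := acts_clauseCode k hm c (acts (clausesCode k cs) w)
    refine ⟨fun t => ⟨rfl, (h1 t).1.trans (i1 t).2⟩, ?_, ?_⟩
    · intro h t
      change (acts (c.code k) (acts (clausesCode k cs) w) t).ends = _
      by_cases hc : c = []
      · rw [h2 hc]
        refine i2 ?_ t
        simpa [hc] using h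
      · exact h3 hc t
    · intro hv t ht
      rw [semicolon_act_res hm c _ (fun t => (i1 t).1)
        (fun t h => (i1 t).2.trans (hv t h)) t ht, i3 hv t ht, List.forall_mem_cons]
      tauto

theorem cons_intercalate {α : Type} (a : α) (ls : List (List α)) (h : ls ≠ []) :
    a :: List.intercalate [a] ls = ls.flatMap fun l => a :: l := by
  induction ls with
  | nil => exact absurd rfl h
  | cons l ls ih =>
    cases ls with
    | nil => simp
    | cons l' ls =>
      rw [List.intercalate_cons_cons, List.flatMap_cons, ← ih (by simp)]
      simp

/-- The coding of the inner part of a formula, with the brackets. -/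
def innerCode {m : ℕ} (k : ℕ) (cs : List (Clause m)) : List QSym :=
  [.lbrack] ++ List.intercalate [QSym.semicolon] (cs.map fun c => Clause.code k c) ++ [.rbrack]

/-- The opening bracket acts as one more semicolon in front of the first clause and then turns the
block ends into group ends. The first part needs no correct values, so it also serves the first
pass. -/
theorem acts_innerCode {m : ℕ} {k : ℕ} (hm : m ≤ 2 ^ k) (cs : List (Clause m))
    (hcs : ∃ c ∈ cs, c ≠ []) (w : ℕ → Track) :
    (∀ t, (acts (innerCode k cs) w t).ends = true ∧ (acts (innerCode k cs) w t).sel = true ∧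
      (acts (innerCode k cs) w t).val = (w t).val ∧
      (acts (innerCode k cs) w t).grp = decide (2 ^ k ∣ t + 1)) ∧
    (HasValues k m w → ∀ t, 2 ^ k ∣ t + 1 → ((acts (innerCode k cs) w t).res = true ↔
      ∀ c ∈ cs, Clause.Sat c fun i => blockAssignment k t i)) := by
  have hne : (cs.map fun c => Clause.code k c) ≠ [] := by
    obtain ⟨c, hc, -⟩ := hcs
    simpa using List.ne_nil_of_mem hc
  obtain ⟨h1, h2, h3⟩ := acts_clausesCode hm cs (QSym.act .rbrack w) fun _ => rfl
  have hact : ∀ v : ℕ → Track, QSym.act .lbrack v = fun t =>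
      { QSym.act .semicolon v t with
        grp := (QSym.act .semicolon v t).ends, ends := true, sel := true } := fun _ => rfl
  have hcode : acts (innerCode k cs) w = fun t =>
      { acts (clausesCode k cs) (QSym.act .rbrack w) t with
        grp := (acts (clausesCode k cs) (QSym.act .rbrack w) t).ends, ends := true, sel := true } := by
    rw [innerCode, acts_append, List.singleton_append, acts_cons, hact, ← acts_cons,
      cons_intercalate _ _ hne, List.flatMap_map]
    rfl
  rw [hcode]
  refine ⟨fun t => ⟨rfl, rfl, (h1 t).2, h2 hcs t⟩, fun hv t ht => ?_⟩
  refine (h3 hv t ht).trans ?_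
  simp [QSym.act, QSym.transduce]

/-! ### The elimination of the quantifiers -/

/-- The quantifier prefix of a coding. -/
def prefixCode (k : ℕ) {j : ℕ} (Q : Fin j → Quantifier) : List QSym :=
  (List.finRange j).reverse.flatMap fun i => (Q i).code :: varName k i

theorem prefixCode_succ (k : ℕ) {j : ℕ} (Q : Fin (j + 1) → Quantifier) :
    prefixCode k Q =
      (Q (Fin.last j)).code :: varName k j ++ prefixCode k fun i => Q i.castSucc := by
  simp only [prefixCode, List.finRange_succ_last, List.reverse_append, List.reverse_singleton,
    List.singleton_append, List.flatMap_cons, ← List.map_reverse, List.flatMap_map]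
  rfl

/-- The assignment that is `v` on the variables below `j` and given by the binary digits of `h`
above. -/
def extend {j : ℕ} (h : ℕ) (v : Fin j → Bool) (i : ℕ) : Bool :=
  if hi : i < j then v ⟨i, hi⟩ else h.testBit (i - j)

/-- Fixing variable `j` to `b` passes from group `h` to its half number `2 * h + b`. -/
theorem extend_snoc {j : ℕ} (h : ℕ) (v : Fin j → Bool) (b : Bool) :
    extend h (Fin.snoc v b : Fin (j + 1) → Bool) = extend (2 * h + b.toNat) v := by
  funext i
  rcases lt_trichotomy i j with hi | rfl | hi
  · rw [extend, extend, dif_pos (by omega), dif_pos hi]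
    exact Fin.snoc_castSucc (α := fun _ => Bool) b v ⟨i, hi⟩
  · rw [extend, extend, dif_pos (by omega), dif_neg (by omega)]
    refine (Fin.snoc_last (α := fun _ => Bool) b v).trans ?_
    cases b <;> simp
  · obtain ⟨d, rfl⟩ : ∃ d, i = j + 1 + d := ⟨i - (j + 1), by omega⟩
    rw [extend, extend, dif_neg (by omega), dif_neg (by omega),
      show j + 1 + d - (j + 1) = d by omega, show j + 1 + d - j = d + 1 by omega,
      ← Nat.testBit_div_two]
    congr 1
    cases b
    · simp
    · simp
      omega

theorem quantifierCode_act (q : Quantifier) (w : ℕ → Track) (t : ℕ) :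
    ((q.code.act w t).ends = true ∧ (q.code.act w t).sel = true) ∧
    (q.code.act w t).val = ((w t).val || ((w t).sel && (memory w t).grpPar)) ∧
    (q.code.act w t).grp = ((w t).grp && (memory w t).grpPar) := by
  cases q <;> exact ⟨⟨rfl, rfl⟩, rfl, rfl⟩

theorem acts_prefixCode {k j : ℕ} (hj : j ≤ 2 ^ k) (Q : Fin j → Quantifier) (w : ℕ → Track)
    (hw : ∀ t, (w t).ends = true ∧ (w t).sel = true ∧ (w t).grp = decide (2 ^ k ∣ t + 1))
    (t : ℕ) :
    ((acts (prefixCode k Q) w t).ends = true ∧ (acts (prefixCode k Q) w t).sel = true ∧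
      (acts (prefixCode k Q) w t).grp = decide (2 ^ (k + j) ∣ t + 1)) ∧
    ((acts (prefixCode k Q) w t).val = true ↔
      (w t).val = true ∨ t % 2 ^ k < j ∧ t.testBit (k + t % 2 ^ k) = true) := by
  induction j generalizing t with
  | zero => simpa [prefixCode, acts] using hw t
  | succ j ih =>
    have ih := ih (by omega) fun i => Q i.castSucc
    rw [prefixCode_succ, List.cons_append, acts_cons, acts_append]
    generalize acts (prefixCode k fun i => Q i.castSucc) w = v at ih ⊢
    have hn := acts_varName k j v (fun t => (ih t).1.1) (fun t => (ih t).1.2.1)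
    obtain ⟨h1, h2, h3⟩ := quantifierCode_act (Q (Fin.last j)) (acts (varName k j) v) t
    have hp : (memory (acts (varName k j) v) t).grpPar = t.testBit (k + j) := by
      simp only [memory, hn, (ih _).1.2.2, par_dvd]
    refine ⟨⟨h1.1, h1.2, ?_⟩, ?_⟩
    · rw [h3, hp, hn]
      change ((v t).grp && _) = _
      rw [(ih t).1.2.2, decide_two_pow_succ_dvd, Nat.add_assoc]
    · rw [h2, hp, hn]
      simp only [Bool.or_eq_true, Bool.and_eq_true, decide_eq_true_iff, (ih t).2,
        Nat.mod_eq_of_lt (show j < 2 ^ k by omega), Nat.lt_succ_iff_lt_or_eq]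
      rw [or_assoc, or_and_right]
      refine or_congr_right (or_congr_right (and_congr_right fun h => ?_))
      rw [h]

/-- A group for `j + 1` consists of two groups for `j`, with variable `j` false in the first and
true in the second. At the end of the second, `lastRes` still holds the result of the first. -/
theorem acts_prefixCode_res {k j : ℕ} (hj : j ≤ 2 ^ k) (Q : Fin j → Quantifier) (w : ℕ → Track)
    (hw : ∀ t, (w t).ends = true ∧ (w t).sel = true ∧ (w t).grp = decide (2 ^ k ∣ t + 1))
    (Φ : (ℕ → Bool) → Prop)
    (hΦ : ∀ t, 2 ^ k ∣ t + 1 → ((w t).res = true ↔ Φ (blockAssignment k t)))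
    (t : ℕ) (ht : 2 ^ (k + j) ∣ t + 1) :
    (acts (prefixCode k Q) w t).res = true ↔
      QuantHolds j Q fun v => Φ (extend (t / 2 ^ (k + j)) v) := by
  induction j generalizing t with
  | zero =>
    refine (hΦ t ht).trans (iff_of_eq (congrArg Φ ?_))
    funext i
    rw [blockAssignment, extend, dif_neg (by omega), Nat.testBit_div_two_pow]
    congr 1
    omega
  | succ j ih =>
    have ih := ih (by omega) fun i => Q i.castSucc
    have hI := acts_prefixCode (by omega) (fun i => Q i.castSucc) w hw
    rw [prefixCode_succ, List.cons_append, acts_cons, acts_append]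
    generalize acts (prefixCode k fun i => Q i.castSucc) w = v at ih hI ⊢
    have hn := acts_varName k j v (fun t => (hI t).1.1) (fun t => (hI t).1.2.1)
    have hp : (memory (acts (varName k j) v) t).grpPar = t.testBit (k + j) := by
      simp only [memory, hn, (hI _).1.2.2, par_dvd]
    obtain ⟨ht1, ht2⟩ := (two_pow_succ_dvd (k + j) t).1 ht
    have hdiv : t / 2 ^ (k + j) = 2 * (t / 2 ^ (k + (j + 1))) + 1 := by
      rw [Nat.testBit_eq_decide_div_mod_eq, decide_eq_true_iff] at ht2
      rw [← Nat.add_assoc, pow_succ, ← Nat.div_div_eq_div_mul]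
      omega
    set h := t / 2 ^ (k + (j + 1)) with hh
    have hl : (memory (acts (varName k j) v) t).lastRes = (v ((2 * h + 1) * 2 ^ (k + j) - 1)).res := by
      simp only [memory, hn, (hI _).1.2.2]
      rw [lastAt_dvd _ _ _ (by omega), hdiv]
    have hq : 0 < 2 ^ (k + j) := by positivity
    have hpos : 0 < (2 * h + 1) * 2 ^ (k + j) := by positivity
    -- This position is the end of the first half, the group with number `2 * h`.
    have hprev := ih ((2 * h + 1) * 2 ^ (k + j) - 1) (by
      rw [Nat.sub_add_cancel hpos]; exact Dvd.intro_left _ rfl)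
    have hdiv' : ((2 * h + 1) * 2 ^ (k + j) - 1) / 2 ^ (k + j) = 2 * h := by
      have : (2 * h + 1) * 2 ^ (k + j) - 1 = 2 ^ (k + j) - 1 + 2 * h * 2 ^ (k + j) := by
        rw [Nat.add_mul]; omega
      rw [this, Nat.add_mul_div_right _ _ hq, Nat.div_eq_of_lt (by omega), zero_add]
    have hcur := ih t ht1
    rw [hdiv'] at hprev
    rw [hdiv] at hcur
    have hg : ((acts (varName k j) v t).grp && t.testBit (k + j)) = true := by
      rw [hn]
      change ((v t).grp && _) = true
      rw [(hI t).1.2.2, ht2]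
      simpa using ht1
    have hr : (acts (varName k j) v t).res = (v t).res := by rw [hn]
    have e0 := extend_snoc (j := j) h (b := false)
    have e1 := extend_snoc (j := j) h (b := true)
    simp only [Bool.toNat_false, Bool.toNat_true, add_zero] at e0 e1
    cases hQ : Q (Fin.last j) with
    | ex =>
      simp only [Quantifier.code, QSym.act, QSym.transduce, hp, hg, if_true, hl, hr,
        Bool.or_eq_true, hprev, hcur, QuantHolds, hQ, Bool.exists_bool, e0, e1]
    | all =>
      simp only [Quantifier.code, QSym.act, QSym.transduce, hp, hg, if_true, hl, hr,
        Bool.and_eq_true, hprev, hcur, QuantHolds, hQ, Bool.forall_bool, e0, e1]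

/-! ### The language -/

theorem QBF.code_eq (k : ℕ) (φ : QBF) : φ.code k = prefixCode k φ.quant ++ innerCode k φ.clauses := by
  simp [QBF.code, prefixCode, innerCode]

theorem length_varName (k i : ℕ) : (varName k i).length = k := by
  simp [varName]

theorem le_length_code (k : ℕ) (φ : QBF) (hm : 0 < φ.m) : k + φ.m ≤ (φ.code k).length := by
  have : (prefixCode k φ.quant).length = φ.m * (k + 1) := by
    simp [prefixCode, List.length_flatMap, length_varName]
  rw [QBF.code_eq, List.length_append, this]
  nlinarith

/-- The language of the strings whose evaluation on the tracks results in the value `true`. -/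
def evalLanguage : Language QSym :=
  {x | (acts x (acts x fun _ => ⟨false, false, false, false, false, false⟩)
    (2 ^ (2 * x.length) - 1)).res = true}

theorem evalLanguage_mem_ExpDAL : evalLanguage ∈ ExpDAL (Sig := QSym) (fun n => n) := by
  have : Finite QSym :=
    @Finite.of_fintype _ ⟨{.ex, .all, .zero, .one, .lbrack, .rbrack, .plus, .minus, .underscore,
      .comma, .semicolon}, fun a => by cases a <;> simp⟩
  refine mem_ExpDAL_of_mealyStream (fun a s c => (Memory.next s c, a.transduce s c)) Memory.start
    ⟨false, false, false, false, false, false⟩ Track.res evalLanguage fun x => ?_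
  simp only [mealyStream_eq_act]
  rfl

theorem mem_evalLanguage_iff {x : List QSym} {φ : QBF} (h : IsCodingOf x φ) :
    x ∈ evalLanguage ↔ φ.IsTrue := by
  obtain ⟨k, hm, hm', hocc, -, rfl⟩ := h
  have hpos : 0 < φ.m := by
    have : 0 < 2 ^ k := by positivity
    omega
  -- Only the reading of a variable name creates the block ends that the opening bracket needs.
  have hne : ∃ c ∈ φ.clauses, c ≠ [] := by
    obtain ⟨c, hc, l, hl, -⟩ := hocc ⟨0, hpos⟩
    exact ⟨c, hc, List.ne_nil_of_mem hl⟩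
  have hI := acts_innerCode hm φ.clauses hne
  have hw : ∀ w t, (acts (innerCode k φ.clauses) w t).ends = true ∧
      (acts (innerCode k φ.clauses) w t).sel = true ∧
      (acts (innerCode k φ.clauses) w t).grp = decide (2 ^ k ∣ t + 1) := fun w t =>
    ⟨((hI w).1 t).1, ((hI w).1 t).2.1, ((hI w).1 t).2.2.2⟩
  set n := (φ.code k).length with hn
  change (acts (φ.code k) (acts (φ.code k) fun _ => ⟨false, false, false, false, false, false⟩)
    (2 ^ (2 * n) - 1)).res = true ↔ _
  -- The result of the first pass: starting from `val` constantly `false`, the prefix has written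
  -- the values.
  have hv : HasValues k φ.m
      (acts (φ.code k) fun _ => ⟨false, false, false, false, false, false⟩) := by
    intro t ht
    rw [Bool.eq_iff_iff, QBF.code_eq, acts_append, (acts_prefixCode hm φ.quant _ (hw _) t).2,
      ((hI _).1 t).2.2.1]
    simp [ht]
  generalize (acts (φ.code k) fun _ => ⟨false, false, false, false, false, false⟩) = w at hv ⊢
  have hlen := le_length_code k φ hpos
  have hdvd : 2 ^ (k + φ.m) ∣ 2 ^ (2 * n) - 1 + 1 := by
    rw [Nat.sub_add_cancel Nat.one_le_two_pow]
    exact pow_dvd_pow 2 (by omega)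
  rw [QBF.code_eq, acts_append, acts_prefixCode_res hm φ.quant _ (hw _)
    (fun a => ∀ c ∈ φ.clauses, Clause.Sat c fun i => a i) ((hI w).2 hv) _ hdvd, QBF.IsTrue]
  refine iff_of_eq (congrArg _ (funext fun v => ?_))
  have : (fun i : Fin φ.m => extend ((2 ^ (2 * n) - 1) / 2 ^ (k + φ.m)) v i) = v := by
    funext i
    rw [extend, dif_pos i.2]
  rw [this]

theorem mainTheorem6 :
    ∃ L : Language QSym, L ∈ ExpDAL (fun n => n) ∧
      ∀ (x : List QSym) (φ : QBF), IsCodingOf x φ → (x ∈ L ↔ φ.IsTrue) :=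
  ⟨evalLanguage, evalLanguage_mem_ExpDAL, fun _ _ => mem_evalLanguage_iff⟩
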